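/- For $p\in[\frac12,1]$ let $(S_n)_{n\ge 0}$ be a random walk on $\mathbb{Z}$ with $S_0=0$ and mutually independent increments $X_n:=S_n-S_{n-1}$, $n\ge 1$, such that $\mathrm{P}[X_n=+1]=p$ and $\mathrm{P}[X_n=-1]=1-p$. Let $R_n:=\#\{1\le k\le n: X_k=+1\}$ and, for a positive integer $d$, let $N_d:=\inf\{n\ge 0: S_n=d\}$. Fix a positive integer $d$. Then, for every $p\in[\frac12,1]$, $N_d$ is almost surely finite and $R_{N_d}/N_d$ is a square-integrable random variable; the map $$p\mapsto \mathrm{E}\bigg[\frac{R_{N_d}}{N_d}\bigg]$$ is strictly increasing over $[\frac12,1]$; moreover, as $p\to 1$ within $[\frac12,1]$, $$\lim_{p\to 1}\mathrm{E}\bigg[\frac{R_{N_d}}{N_d}\bigg]=1\quad\text{and}\quad \lim_{p\to 1}\mathrm{Var}\bigg[\frac{R_{N_d}}{N_d}\bigg]=0.$$ -/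

import Mathlib

open MeasureTheory ProbabilityTheory Filter Topology

/-- The `n`-th increment `X_n = S_n - S_{n-1}` of an integer-valued process (used for `n ≥ 1`). -/
def increment {Ω : Type*} (S : ℕ → Ω → ℤ) (n : ℕ) (ω : Ω) : ℤ :=
  S n ω - S (n - 1) ω

/-- `S` is a simple random walk on `ℤ` started at `0` under the probability measure `P`: the
increments `X_1, X_2, …` are mutually independent, with `P[X_n = 1] = p` and
`P[X_n = -1] = 1 - p`. -/
structure IsBiasedWalk {Ω : Type*} [MeasurableSpace Ω] (P : Measure Ω) (p : ℝ)
    (S : ℕ → Ω → ℤ) : Prop where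
  isProbabilityMeasure : IsProbabilityMeasure P
  measurable : ∀ n, Measurable (S n)
  start : ∀ ω, S 0 ω = 0
  indep : iIndepFun (fun n : ℕ => increment S (n + 1)) P
  prob_up : ∀ n, 1 ≤ n → P {ω | increment S n ω = 1} = ENNReal.ofReal p
  prob_down : ∀ n, 1 ≤ n → P {ω | increment S n ω = -1} = ENNReal.ofReal (1 - p)

/-- `R_n`, the number of `k ∈ {1, …, n}` with `X_k = 1`. -/
def numWins {Ω : Type*} (S : ℕ → Ω → ℤ) (n : ℕ) (ω : Ω) : ℕ :=
  ((Finset.Icc 1 n).filter (fun k => increment S k ω = 1)).card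

/-- `N_d = inf {n ≥ 0 : S_n = d}`, equal to `⊤` if the walk never hits `d`. -/
noncomputable def hitTime {Ω : Type*} (S : ℕ → Ω → ℤ) (d : ℕ) : Ω → WithTop ℕ :=
  hittingAfter S {(d : ℤ)} 0

/-- The win rate `R_{N_d} / N_d` (with the value `0` if `N_d = ∞`). -/
noncomputable def winRate {Ω : Type*} (S : ℕ → Ω → ℤ) (d : ℕ) (ω : Ω) : ℝ :=
  (numWins S ((hitTime S d ω).untopD 0) ω : ℝ) / ((hitTime S d ω).untopD 0 : ℕ)

/-! At the hitting time `N` of `d`, the identity `S N = 2 * R N - N` gives win rate `1/2 + d / (2 *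
N)`, so hitting sooner means a larger rate. Since the law of the rate depends only on `p`
(`IsBiasedWalk.identDistrib_winRate`), all walks may be driven by the same uniform variables
(`thresholdWalk`); a larger `p` then gives a dominating path and hence a larger rate. With positive
probability the larger bias wins its first `d` steps while the smaller one loses step one, so
monotonicity is strict. Winning the first `d` steps also gives `p ^ d ≤ E ≤ 1`, and a rate in `[0,
1]` has variance at most `1 - E ^ 2`; both limits follow. Only almost sure finiteness needs `p ≥
1/2`: a submartingale with bounded steps that stays below `d` would converge, which steps `±1`
forbid. -/

/-! ### Deterministic facts about a single path. -/

section Pathwise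

variable {Ω : Type*} {S : ℕ → Ω → ℤ} {d : ℕ} {ω : Ω}

/-- The paths of a simple walk: they start at `0` and have steps `±1`. -/
structure IsSimplePath {Ω : Type*} (S : ℕ → Ω → ℤ) (ω : Ω) : Prop where
  start : S 0 ω = 0
  step : ∀ n, increment S (n + 1) ω = 1 ∨ increment S (n + 1) ω = -1

lemma increment_succ (n : ℕ) : increment S (n + 1) ω = S (n + 1) ω - S n ω := rfl

/-- The default `0` agrees with `sInf ∅ = 0`, so `WithTop` can be dropped. -/
lemma untopD_hitTime (S : ℕ → Ω → ℤ) (d : ℕ) (ω : Ω) :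
    (hitTime S d ω).untopD 0 = sInf {n | S n ω = (d : ℤ)} := by
  classical
  by_cases h : ∃ j, S j ω = (d : ℤ)
  · simp only [hitTime, hittingAfter, Set.mem_singleton_iff, zero_le, true_and, h, if_true]
    rfl
  · have h' : {n | S n ω = (d : ℤ)} = ∅ := by
      ext n
      simpa using fun hn => h ⟨n, hn⟩
    simp [hitTime, hittingAfter, h, h']

lemma hitTime_ne_top_iff : hitTime S d ω ≠ ⊤ ↔ ∃ j, S j ω = (d : ℤ) := by
  simp [hitTime, hittingAfter_eq_top_iff]

lemma winRate_eq (S : ℕ → Ω → ℤ) (d : ℕ) (ω : Ω) :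
    winRate S d ω = (numWins S (sInf {n | S n ω = (d : ℤ)}) ω : ℝ)
      / (sInf {n | S n ω = (d : ℤ)} : ℕ) := by
  rw [winRate, untopD_hitTime]

lemma winRate_congr {Ω' : Type*} {S' : ℕ → Ω' → ℤ} {ω' : Ω'} (h : ∀ n, S n ω = S' n ω') :
    winRate S d ω = winRate S' d ω' := by
  rw [winRate_eq, winRate_eq]
  simp only [numWins, increment, h]
  congr

lemma numWins_le (S : ℕ → Ω → ℤ) (n : ℕ) (ω : Ω) : numWins S n ω ≤ n := by
  simpa [numWins] using Finset.card_filter_le (Finset.Icc 1 n) (fun k => increment S k ω = 1)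

lemma numWins_succ (n : ℕ) :
    numWins S (n + 1) ω = numWins S n ω + if increment S (n + 1) ω = 1 then 1 else 0 := by
  unfold numWins
  rw [← Finset.insert_Icc_right_eq_Icc_add_one (by omega), Finset.filter_insert]
  split_ifs with h
  · rw [Finset.card_insert_of_notMem (by simp)]
  · rfl

lemma winRate_nonneg (S : ℕ → Ω → ℤ) (d : ℕ) (ω : Ω) : 0 ≤ winRate S d ω := by
  unfold winRate
  positivity

lemma winRate_le_one (S : ℕ → Ω → ℤ) (d : ℕ) (ω : Ω) : winRate S d ω ≤ 1 :=
  div_le_one_of_le₀ (by exact_mod_cast numWins_le S _ ω) (by positivity)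

lemma winRate_lt_one (h : increment S 1 ω ≠ 1) : winRate S d ω < 1 := by
  rw [winRate_eq]
  generalize sInf {n | S n ω = (d : ℤ)} = n
  rcases Nat.eq_zero_or_pos n with rfl | hn
  · simp
  · rw [div_lt_one (by exact_mod_cast hn)]
    have : numWins S n ω < (Finset.Icc 1 n).card :=
      Finset.card_lt_card (Finset.filter_ssubset.2 ⟨1, by simp; omega, h⟩)
    simpa using this

lemma winRate_eq_one (hd : 0 < d) (h0 : S 0 ω = 0) (h : ∀ k < d, increment S (k + 1) ω = 1) :
    winRate S d ω = 1 := by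
  have hS : ∀ k ≤ d, S k ω = k := by
    intro k
    induction k with
    | zero => simp [h0]
    | succ k ih =>
      intro hk
      have := h k hk
      rw [increment_succ, ih (by omega)] at this
      push_cast
      omega
  have hinf : sInf {n | S n ω = (d : ℤ)} = d := by
    have hmem := Nat.sInf_mem (s := {n | S n ω = (d : ℤ)}) ⟨d, hS d le_rfl⟩
    have hle := Nat.sInf_le (s := {n | S n ω = (d : ℤ)}) (hS d le_rfl)
    have := hS _ hle
    rw [Set.mem_ofPred_eq] at hmem
    omega
  have hwins : numWins S d ω = d := by
    unfold numWins
    rw [Finset.filter_true_of_mem]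
    · simp
    · intro k hk
      obtain ⟨h1, h2⟩ := Finset.mem_Icc.1 hk
      obtain ⟨j, rfl⟩ : ∃ j, k = j + 1 := ⟨k - 1, by omega⟩
      exact h j (by omega)
  rw [winRate_eq, hinf, hwins]
  exact div_self (by exact_mod_cast hd.ne')

lemma IsSimplePath.eq_two_mul_numWins_sub (h : IsSimplePath S ω) (n : ℕ) :
    S n ω = 2 * numWins S n ω - n := by
  induction n with
  | zero => simp [h.start, numWins]
  | succ n ih =>
    have hs := h.step n
    have hi := increment_succ (S := S) (ω := ω) n
    rw [numWins_succ]
    rcases hs with hs | hs <;> simp [hs] <;> omega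

/-- A simple path that is at or above `d` has passed through `d`. -/
lemma IsSimplePath.exists_hit (h : IsSimplePath S ω) {m : ℕ} (hm : (d : ℤ) ≤ S m ω) :
    ∃ j ≤ m, S j ω = (d : ℤ) := by
  induction m with
  | zero => exact ⟨0, le_rfl, by have := h.start; omega⟩
  | succ m ih =>
    by_cases hlt : (d : ℤ) ≤ S m ω
    · obtain ⟨j, hj, hjd⟩ := ih hlt
      exact ⟨j, by omega, hjd⟩
    · refine ⟨m + 1, le_rfl, ?_⟩
      have hs := h.step m
      rw [increment_succ] at hs
      omega

lemma IsSimplePath.winRate_eq_half_add (h : IsSimplePath S ω) (hd : 0 < d)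
    (hit : ∃ j, S j ω = (d : ℤ)) :
    0 < sInf {n | S n ω = (d : ℤ)} ∧
      winRate S d ω = 1 / 2 + d / (2 * (sInf {n | S n ω = (d : ℤ)} : ℕ)) := by
  have hmem := Nat.sInf_mem (s := {n | S n ω = (d : ℤ)}) hit
  rw [winRate_eq]
  generalize sInf {n | S n ω = (d : ℤ)} = n at hmem
  have hmem : S n ω = (d : ℤ) := hmem
  have hn : 0 < n := by
    rcases Nat.eq_zero_or_pos n with rfl | hn
    · have := h.start
      omega
    · exact hn
  refine ⟨hn, ?_⟩
  have hw : (d : ℝ) = 2 * numWins S n ω - n := by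
    exact_mod_cast hmem.symm.trans (h.eq_two_mul_numWins_sub n)
  have hn' : (n : ℝ) ≠ 0 := by exact_mod_cast hn.ne'
  rw [hw]
  field_simp
  ring

/-- A dominating simple path hits `d` sooner, so it has a larger win rate. -/
lemma IsSimplePath.winRate_mono {S' : ℕ → Ω → ℤ} (h : IsSimplePath S ω)
    (h' : IsSimplePath S' ω) (hd : 0 < d) (hle : ∀ n, S n ω ≤ S' n ω) :
    winRate S d ω ≤ winRate S' d ω := by
  by_cases hit : ∃ j, S j ω = (d : ℤ)
  · have hmem : S (sInf {n | S n ω = (d : ℤ)}) ω = d :=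
      Nat.sInf_mem (s := {n | S n ω = (d : ℤ)}) hit
    obtain ⟨j, hj, hjd⟩ := h'.exists_hit (hmem.symm.le.trans (hle _))
    obtain ⟨-, e⟩ := h.winRate_eq_half_add hd hit
    obtain ⟨hpos, e'⟩ := h'.winRate_eq_half_add hd ⟨j, hjd⟩
    have hinf : sInf {n | S' n ω = (d : ℤ)} ≤ sInf {n | S n ω = (d : ℤ)} :=
      (Nat.sInf_le (s := {n | S' n ω = (d : ℤ)}) hjd).trans hj
    rw [e, e']
    gcongr
  -- A path that never hits has rate `0 / 0 = 0`, below every other rate.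
  · have htop : sInf {n | S n ω = (d : ℤ)} = 0 := by
      rw [Nat.sInf_eq_zero]
      right
      ext n
      simpa using fun hn => hit ⟨n, hn⟩
    rw [winRate_eq, htop]
    simpa using winRate_nonneg S' d ω

end Pathwise

/-! ### Measurability and integrability of the win rate. -/

section Measurability

variable {Ω : Type*} [MeasurableSpace Ω] {S : ℕ → Ω → ℤ}

lemma measurable_increment (hS : ∀ n, Measurable (S n)) (n : ℕ) : Measurable (increment S n) :=
  (hS n).sub (hS (n - 1))

lemma measurable_numWins (hS : ∀ n, Measurable (S n)) (n : ℕ) : Measurable (numWins S n) := by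
  have : numWins S n = fun ω => ∑ k ∈ Finset.Icc 1 n, if increment S k ω = 1 then 1 else 0 := by
    ext ω
    rw [numWins, Finset.card_filter]
  rw [this]
  refine Finset.measurable_sum _ fun k _ => ?_
  exact Measurable.ite (measurable_increment hS k (measurableSet_singleton 1))
    measurable_const measurable_const

lemma measurable_sInf_hit (hS : ∀ n, Measurable (S n)) (d : ℕ) :
    Measurable fun ω => sInf {n | S n ω = (d : ℤ)} := by
  refine measurable_to_countable' fun n => ?_
  have hsets : ∀ k, MeasurableSet {ω | S k ω = (d : ℤ)} := fun k =>
    hS k (measurableSet_singleton _)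
  have heq : (fun ω => sInf {k | S k ω = (d : ℤ)}) ⁻¹' {n} =
      {ω | (S n ω = d ∧ ∀ k < n, ¬ S k ω = d) ∨ (n = 0 ∧ ∀ k, ¬ S k ω = d)} := by
    ext ω
    simp only [Set.mem_preimage, Set.mem_singleton_iff, Set.mem_ofPred_eq]
    constructor
    · rintro rfl
      by_cases hit : ∃ j, S j ω = (d : ℤ)
      · exact Or.inl ⟨Nat.sInf_mem (s := {n | S n ω = (d : ℤ)}) hit,
          fun k hk => Nat.notMem_of_lt_sInf hk⟩
      · push Not at hit
        exact Or.inr ⟨by simp [hit], hit⟩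
    · rintro (⟨h1, h2⟩ | ⟨rfl, h⟩)
      · refine le_antisymm (Nat.sInf_le h1) ?_
        by_contra! hlt
        exact h2 _ hlt (Nat.sInf_mem (s := {n | S n ω = (d : ℤ)}) ⟨n, h1⟩)
      · simp [h]
  rw [heq]
  measurability

lemma measurable_winRate (hS : ∀ n, Measurable (S n)) (d : ℕ) : Measurable (winRate S d) := by
  have hN := measurable_sInf_hit hS d
  have hR : Measurable fun ω => numWins S (sInf {n | S n ω = (d : ℤ)}) ω := by
    -- Joint measurability, as time is countable, allows evaluation at a random time.
    have : Measurable fun x : Ω × ℕ => numWins S x.2 x.1 :=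
      measurable_from_prod_countable_left fun n => measurable_numWins hS n
    exact this.comp (measurable_id.prodMk hN)
  have : winRate S d = fun ω => (numWins S (sInf {n | S n ω = (d : ℤ)}) ω : ℝ)
      / (sInf {n | S n ω = (d : ℤ)} : ℕ) := funext (winRate_eq S d)
  rw [this]
  exact (measurable_from_top.comp hR).div (measurable_from_top.comp hN)

lemma memLp_winRate {P : Measure Ω} [IsFiniteMeasure P] (hS : ∀ n, Measurable (S n)) (d : ℕ)
    (q : ENNReal) : MemLp (winRate S d) q P :=
  MemLp.of_bound (measurable_winRate hS d).aestronglyMeasurable 1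
    (ae_of_all _ fun ω => by
      rw [Real.norm_of_nonneg (winRate_nonneg S d ω)]
      exact winRate_le_one S d ω)

end Measurability

/-! ### The law of the increments determines that of the win rate. -/

section Law

variable {Ω : Type*} [MeasurableSpace Ω] {P : Measure Ω} {p : ℝ} {S : ℕ → Ω → ℤ}

omit [MeasurableSpace Ω] in
lemma sum_increment (h0 : ∀ ω, S 0 ω = 0) (n : ℕ) (ω : Ω) :
    ∑ k ∈ Finset.range n, increment S (k + 1) ω = S n ω := by
  simp only [increment_succ]
  rw [Finset.sum_range_sub (fun k => S k ω), h0, sub_zero]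

lemma IsBiasedWalk.ae_step (h : IsBiasedWalk P p S) (hp : p ∈ Set.Icc (0 : ℝ) 1) :
    ∀ᵐ ω ∂P, ∀ n, increment S (n + 1) ω = 1 ∨ increment S (n + 1) ω = -1 := by
  have := h.isProbabilityMeasure
  rw [ae_all_iff]
  intro n
  have hm := measurable_increment h.measurable (n + 1)
  have h1 : MeasurableSet {ω | increment S (n + 1) ω = 1} := hm (measurableSet_singleton 1)
  have h2 : MeasurableSet {ω | increment S (n + 1) ω = -1} := hm (measurableSet_singleton (-1))
  have hdisj : Disjoint {ω | increment S (n + 1) ω = 1} {ω | increment S (n + 1) ω = -1} := by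
    rw [Set.disjoint_left]
    intro ω ha hb
    rw [Set.mem_ofPred_eq] at ha hb
    omega
  have hu := measure_union (μ := P) hdisj h2
  rw [h.prob_up _ (by omega), h.prob_down _ (by omega),
    ← ENNReal.ofReal_add hp.1 (by linarith [hp.2]), add_sub_cancel, ENNReal.ofReal_one] at hu
  exact (prob_compl_eq_zero_iff (h1.union h2)).2 hu

lemma IsBiasedWalk.ae_isSimplePath (h : IsBiasedWalk P p S) (hp : p ∈ Set.Icc (0 : ℝ) 1) :
    ∀ᵐ ω ∂P, IsSimplePath S ω := by
  filter_upwards [h.ae_step hp] with ω hω using ⟨h.start ω, hω⟩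

lemma IsBiasedWalk.map_increment (h : IsBiasedWalk P p S) (hp : p ∈ Set.Icc (0 : ℝ) 1) (n : ℕ) :
    P.map (increment S (n + 1)) =
      ENNReal.ofReal p • Measure.dirac 1 + ENNReal.ofReal (1 - p) • Measure.dirac (-1) := by
  have hm := measurable_increment h.measurable (n + 1)
  refine Measure.ext_of_singleton fun z => ?_
  rw [Measure.map_apply hm (measurableSet_singleton z)]
  by_cases h1 : z = 1
  · subst h1
    have hup : P (increment S (n + 1) ⁻¹' {1}) = ENNReal.ofReal p := h.prob_up (n + 1) (by omega)
    simp [hup]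
  by_cases h2 : z = -1
  · subst h2
    have hdown : P (increment S (n + 1) ⁻¹' {-1}) = ENNReal.ofReal (1 - p) :=
      h.prob_down (n + 1) (by omega)
    simp [hdown]
  · have : P (increment S (n + 1) ⁻¹' {z}) = 0 := by
      refine measure_mono_null ?_ (h.ae_step hp)
      intro ω hω hall
      rw [Set.mem_preimage, Set.mem_singleton_iff] at hω
      have := hall n
      omega
    simp [this, Ne.symm h1, Ne.symm h2]

/-- The law of the win rate depends only on the bias of the walk. -/
lemma IsBiasedWalk.identDistrib_winRate {Ω' : Type*} [MeasurableSpace Ω'] {P' : Measure Ω'}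
    {S' : ℕ → Ω' → ℤ} (h : IsBiasedWalk P p S) (h' : IsBiasedWalk P' p S')
    (hp : p ∈ Set.Icc (0 : ℝ) 1) (d : ℕ) :
    IdentDistrib (winRate S d) (winRate S' d) P P' := by
  have hm := fun n => measurable_increment h.measurable (n + 1)
  have hm' := fun n => measurable_increment h'.measurable (n + 1)
  have hid : IdentDistrib (fun ω n => increment S (n + 1) ω)
      (fun ω n => increment S' (n + 1) ω) P P' := by
    refine ⟨(measurable_pi_lambda _ hm).aemeasurable, (measurable_pi_lambda _ hm').aemeasurable, ?_⟩
    -- By independence, both joint laws are products of marginals fixed by `p`.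
    rw [h.indep.map_fun_eq_infinitePi_map hm, h'.indep.map_fun_eq_infinitePi_map hm']
    simp only [h.map_increment hp, h'.map_increment hp]
  have hW : Measurable
      (winRate (fun n (x : ℕ → ℤ) => ∑ k ∈ Finset.range n, x k) d) :=
    measurable_winRate (fun n => Finset.measurable_sum _ fun k _ => measurable_pi_apply k) d
  convert hid.comp hW using 1
  · exact funext fun ω => winRate_congr fun n => (sum_increment h.start n ω).symm
  · exact funext fun ω => winRate_congr fun n => (sum_increment h'.start n ω).symm

end Law

/-! ### Almost sure finiteness of the hitting time. -/

section Recurrence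

variable {Ω : Type*} [MeasurableSpace Ω] {P : Measure Ω} {p : ℝ} {S : ℕ → Ω → ℤ}

lemma IsBiasedWalk.integrable_increment (h : IsBiasedWalk P p S) (hp : p ∈ Set.Icc (0 : ℝ) 1)
    (n : ℕ) : Integrable (fun ω => (increment S (n + 1) ω : ℝ)) P := by
  have := h.isProbabilityMeasure
  refine Integrable.of_bound
    (measurable_from_top.comp (measurable_increment h.measurable (n + 1))).aestronglyMeasurable 1 ?_
  filter_upwards [h.ae_step hp] with ω hω
  rcases hω n with h1 | h1 <;> simp [h1]

lemma IsBiasedWalk.integral_increment (h : IsBiasedWalk P p S) (hp : p ∈ Set.Icc (0 : ℝ) 1)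
    (n : ℕ) : ∫ ω, (increment S (n + 1) ω : ℝ) ∂P = 2 * p - 1 := by
  have hm := measurable_increment h.measurable (n + 1)
  rw [← integral_map (f := fun z : ℤ => (z : ℝ)) hm.aemeasurable
    (measurable_from_top (f := fun z : ℤ => (z : ℝ))).aestronglyMeasurable, h.map_increment hp,
    integral_add_measure, integral_smul_measure, integral_smul_measure, integral_dirac,
    integral_dirac, ENNReal.toReal_ofReal hp.1, ENNReal.toReal_ofReal (by linarith [hp.2])]
  · simp
    ring
  · exact (integrable_dirac (by simp)).smul_measure ENNReal.ofReal_ne_top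
  · exact (integrable_dirac (by simp)).smul_measure ENNReal.ofReal_ne_top

/-- A walk without negative drift is, from time `1` on, a submartingale. -/
lemma IsBiasedWalk.exists_submartingale (h : IsBiasedWalk P p S)
    (hp : p ∈ Set.Icc (1 / 2 : ℝ) 1) :
    ∃ ℱ : Filtration ℕ ‹MeasurableSpace Ω›, Submartingale (fun n ω => (S (n + 1) ω : ℝ)) ℱ P := by
  have := h.isProbabilityMeasure
  have hp' : p ∈ Set.Icc (0 : ℝ) 1 := ⟨by linarith [hp.1], hp.2⟩
  have hX : ∀ n, StronglyMeasurable fun ω => (increment S (n + 1) ω : ℝ) := fun n =>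
    (measurable_from_top.comp (measurable_increment h.measurable (n + 1))).stronglyMeasurable
  have hind : iIndepFun (fun n ω => (increment S (n + 1) ω : ℝ)) P :=
    h.indep.comp (fun _ (z : ℤ) => (z : ℝ)) fun _ => measurable_from_top
  have hsum : ∀ n, (fun ω => (S n ω : ℝ)) =
      fun ω => ∑ k ∈ Finset.range n, (increment S (k + 1) ω : ℝ) := by
    intro n
    ext ω
    exact_mod_cast (sum_increment h.start n ω).symm
  -- Index `n` of this filtration already knows the step into time `n + 1`, hence the shift.
  refine ⟨Filtration.natural _ hX, submartingale_of_condExp_sub_nonneg_nat ?_ ?_ ?_⟩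
  · intro n
    beta_reduce
    rw [hsum]
    refine Finset.stronglyMeasurable_fun_sum _ fun k hk => ?_
    exact (Filtration.stronglyAdapted_natural hX k).mono
      ((Filtration.natural _ hX).mono (by simpa [Nat.lt_succ_iff] using hk))
  · intro n
    rw [hsum]
    exact integrable_finsetSum _ fun k _ => h.integrable_increment hp' k
  · intro n
    have hdiff : ((fun ω => (S (n + 1 + 1) ω : ℝ)) - fun ω => (S (n + 1) ω : ℝ)) =
        fun ω => (increment S (n + 1 + 1) ω : ℝ) := by
      ext ω
      simp [increment_succ]
    have hc := condExp_indep_eq (hX (n + 1)).measurable.comap_le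
      ((Filtration.natural _ hX).le n) (comap_measurable _).stronglyMeasurable
      (hind.indep_comap_natural_of_lt hX (Nat.lt_succ_self n))
    rw [hdiff]
    filter_upwards [hc] with ω hω
    rw [hω, h.integral_increment hp']
    simpa using by linarith [hp.1]

/-- A walk without negative drift almost surely hits every level `d ≥ 0`. -/
lemma IsBiasedWalk.ae_exists_hit (h : IsBiasedWalk P p S) (hp : p ∈ Set.Icc (1 / 2 : ℝ) 1)
    (d : ℕ) : ∀ᵐ ω ∂P, ∃ j, S j ω = (d : ℤ) := by
  have := h.isProbabilityMeasure
  have hp' : p ∈ Set.Icc (0 : ℝ) 1 := ⟨by linarith [hp.1], hp.2⟩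
  obtain ⟨ℱ, hsub⟩ := h.exists_submartingale hp
  have habs : ∀ ω, IsSimplePath S ω → ∀ n, |(S (n + 1) ω : ℝ) - S n ω| = 1 := by
    intro ω hω n
    have hs := hω.step n
    rw [increment_succ] at hs
    have : |S (n + 1) ω - S n ω| = 1 := by rcases hs with hs | hs <;> simp [hs]
    exact_mod_cast this
  have hbdd := hsub.bddAbove_iff_exists_tendsto (R := 1) (by
    filter_upwards [h.ae_isSimplePath hp'] with ω hω n
    simpa using (habs ω hω (n + 1)).le)
  filter_upwards [h.ae_isSimplePath hp', hbdd] with ω hω hiff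
  by_contra hnot
  have hlt : ∀ m, S m ω < d := by
    intro m
    by_contra! hm
    obtain ⟨j, -, hj⟩ := hω.exists_hit hm
    exact hnot ⟨j, hj⟩
  obtain ⟨c, hc⟩ := hiff.1 ⟨d, by
    rintro _ ⟨n, rfl⟩
    beta_reduce
    exact_mod_cast (hlt (n + 1)).le⟩
  have hzero := ((hc.comp (tendsto_add_atTop_nat 1)).sub hc).abs
  -- Convergence would force the step sizes, all `1`, to tend to `0`.
  have hone : Tendsto (fun _ : ℕ => (1 : ℝ)) atTop (𝓝 |c - c|) :=
    hzero.congr fun n => habs ω hω (n + 1)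
  have := tendsto_nhds_unique hone tendsto_const_nhds
  simp at this

end Recurrence

/-! ### Monotone coupling through uniform variables, and the limits. -/

section Coupling

open scoped unitInterval

/-- The walk whose `k`-th step is up when the `k`-th coordinate is at most `p`. -/
noncomputable def thresholdWalk (p : ℝ) (n : ℕ) (u : ℕ → I) : ℤ :=
  ∑ k ∈ Finset.range n, if (u k : ℝ) ≤ p then 1 else -1

/-- The law of a sequence of independent uniform random variables. -/
noncomputable def uniformSeq : Measure (ℕ → I) := Measure.infinitePi fun _ => volume

instance : IsProbabilityMeasure uniformSeq := by
  unfold uniformSeq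
  infer_instance

variable {p q : ℝ} {u : ℕ → I} {d : ℕ}

lemma increment_thresholdWalk (p : ℝ) (n : ℕ) (u : ℕ → I) :
    increment (thresholdWalk p) (n + 1) u = if (u n : ℝ) ≤ p then 1 else -1 := by
  simp [increment_succ, thresholdWalk, Finset.sum_range_succ]

lemma isSimplePath_thresholdWalk (p : ℝ) (u : ℕ → I) : IsSimplePath (thresholdWalk p) u where
  start := by simp [thresholdWalk]
  step n := by
    rw [increment_thresholdWalk]
    split_ifs <;> simp

lemma thresholdWalk_mono (hpq : p ≤ q) (n : ℕ) (u : ℕ → I) :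
    thresholdWalk p n u ≤ thresholdWalk q n u := by
  refine Finset.sum_le_sum fun k _ => ?_
  split_ifs <;> first | omega | (exfalso; linarith)

lemma measurable_thresholdStep (p : ℝ) :
    Measurable fun x : I => if (x : ℝ) ≤ p then (1 : ℤ) else -1 :=
  Measurable.ite (measurableSet_le measurable_subtype_coe measurable_const)
    measurable_const measurable_const

lemma measurable_thresholdWalk (p : ℝ) (n : ℕ) : Measurable (thresholdWalk p n) :=
  Finset.measurable_sum _ fun k _ => (measurable_thresholdStep p).comp (measurable_pi_apply k)

lemma volume_coe_le (hp : p ∈ Set.Icc (0 : ℝ) 1) :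
    volume {x : I | (x : ℝ) ≤ p} = ENNReal.ofReal p :=
  unitInterval.volume_Iic ⟨p, hp⟩

lemma volume_coe_gt (hp : p ∈ Set.Icc (0 : ℝ) 1) :
    volume {x : I | p < (x : ℝ)} = ENNReal.ofReal (1 - p) :=
  unitInterval.volume_Ioi ⟨p, hp⟩

lemma volume_coe_Ioc (hp : p ∈ Set.Icc (0 : ℝ) 1) (hq : q ∈ Set.Icc (0 : ℝ) 1) :
    volume {x : I | p < (x : ℝ) ∧ (x : ℝ) ≤ q} = ENNReal.ofReal (q - p) :=
  unitInterval.volume_Ioc ⟨p, hp⟩ ⟨q, hq⟩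

lemma uniformSeq_coord (n : ℕ) {s : Set I} (hs : MeasurableSet s) :
    uniformSeq {u | u n ∈ s} = volume s := by
  rw [← Measure.infinitePi_map_eval (fun _ : ℕ => (volume : Measure I)) n,
    Measure.map_apply (measurable_pi_apply n) hs]
  rfl

lemma isBiasedWalk_thresholdWalk (hp : p ∈ Set.Icc (0 : ℝ) 1) :
    IsBiasedWalk uniformSeq p (thresholdWalk p) where
  isProbabilityMeasure := inferInstance
  measurable := measurable_thresholdWalk p
  start u := (isSimplePath_thresholdWalk p u).start
  indep := by
    have := iIndepFun_infinitePi (P := fun _ : ℕ => (volume : Measure I))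
      (X := fun _ x => if (x : ℝ) ≤ p then (1 : ℤ) else -1) fun _ => measurable_thresholdStep p
    have heq : (fun n => increment (thresholdWalk p) (n + 1)) =
        fun n (u : ℕ → I) => if (u n : ℝ) ≤ p then (1 : ℤ) else -1 :=
      funext fun n => funext fun u => increment_thresholdWalk p n u
    rwa [heq, uniformSeq]
  prob_up n hn := by
    obtain ⟨m, rfl⟩ : ∃ m, n = m + 1 := ⟨n - 1, by omega⟩
    rw [← volume_coe_le hp, ← uniformSeq_coord m
      (measurableSet_le measurable_subtype_coe measurable_const)]
    congr 1
    ext u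
    simp [increment_thresholdWalk]
  prob_down n hn := by
    obtain ⟨m, rfl⟩ : ∃ m, n = m + 1 := ⟨n - 1, by omega⟩
    rw [← volume_coe_gt hp, ← uniformSeq_coord m
      (measurableSet_lt measurable_const measurable_subtype_coe)]
    congr 1
    ext u
    simp [increment_thresholdWalk]

lemma winRate_thresholdWalk_eq_one (hd : 0 < d) (hu : ∀ k < d, (u k : ℝ) ≤ p) :
    winRate (thresholdWalk p) d u = 1 :=
  winRate_eq_one hd (isSimplePath_thresholdWalk p u).start fun k hk => by
    rw [increment_thresholdWalk, if_pos (hu k hk)]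

lemma integrable_winRate_thresholdWalk (p : ℝ) (d : ℕ) :
    Integrable (winRate (thresholdWalk p) d) uniformSeq :=
  (memLp_winRate (measurable_thresholdWalk p) d 1).integrable le_rfl

lemma strictMonoOn_integral_winRate (hd : 0 < d) :
    StrictMonoOn (fun p => ∫ u, winRate (thresholdWalk p) d u ∂uniformSeq)
      (Set.Icc (0 : ℝ) 1) := by
  intro p hp q hq hpq
  have hle : ∀ u, winRate (thresholdWalk p) d u ≤ winRate (thresholdWalk q) d u := fun u =>
    (isSimplePath_thresholdWalk p u).winRate_mono (isSimplePath_thresholdWalk q u) hd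
      fun n => thresholdWalk_mono hpq.le n u
  refine (integral_mono (integrable_winRate_thresholdWalk p d)
    (integrable_winRate_thresholdWalk q d) hle).lt_of_ne fun heq => ?_
  have hae := (integral_eq_iff_of_ae_le (integrable_winRate_thresholdWalk p d)
    (integrable_winRate_thresholdWalk q d) (ae_of_all _ hle)).1 heq
  -- On this cylinder the `q`-walk wins `d` times in a row, while the `p`-walk loses at once.
  set t : ℕ → Set I := fun k => if k = 0 then {x : I | p < (x : ℝ) ∧ (x : ℝ) ≤ q}
    else {x : I | (x : ℝ) ≤ q} with ht
  have hsub : Set.pi (Finset.range d) t ⊆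
      {u | ¬ winRate (thresholdWalk p) d u = winRate (thresholdWalk q) d u} := by
    intro u hu
    have hu' : ∀ k < d, u k ∈ t k := fun k hk => hu k (by simpa using hk)
    have hone : winRate (thresholdWalk q) d u = 1 := by
      refine winRate_thresholdWalk_eq_one hd fun k hk => ?_
      have := hu' k hk
      simp only [ht] at this
      split_ifs at this
      · exact this.2
      · exact this
    rw [Set.mem_ofPred_eq, hone]
    refine (winRate_lt_one ?_).ne
    have h0 := hu' 0 hd
    simp only [ht, if_true] at h0
    rw [show (1 : ℕ) = 0 + 1 from rfl, increment_thresholdWalk, if_neg (not_le.2 h0.1)]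
    decide
  have hnull := measure_mono_null hsub (ae_iff.1 hae)
  rw [uniformSeq, Measure.infinitePi_pi, Finset.prod_eq_zero_iff] at hnull
  · obtain ⟨k, -, hk⟩ := hnull
    simp only [ht] at hk
    split_ifs at hk
    · rw [volume_coe_Ioc hp hq, ENNReal.ofReal_eq_zero] at hk
      linarith
    · rw [volume_coe_le hq, ENNReal.ofReal_eq_zero] at hk
      linarith [hp.1]
  · intro k _
    have h1 : MeasurableSet {x : I | (x : ℝ) ≤ q} :=
      measurableSet_le measurable_subtype_coe measurable_const
    have h2 : MeasurableSet {x : I | p < (x : ℝ)} :=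
      measurableSet_lt measurable_const measurable_subtype_coe
    simp only [ht]
    split_ifs
    · exact h2.inter h1
    · exact h1

lemma pow_le_integral_winRate (hd : 0 < d) (hp : p ∈ Set.Icc (0 : ℝ) 1) :
    p ^ d ≤ ∫ u, winRate (thresholdWalk p) d u ∂uniformSeq := by
  have hmeas : MeasurableSet {x : I | (x : ℝ) ≤ p} :=
    measurableSet_le measurable_subtype_coe measurable_const
  set E : Set (ℕ → I) := Set.pi (Finset.range d) fun _ => {x : I | (x : ℝ) ≤ p} with hE
  have hEm : MeasurableSet E :=
    MeasurableSet.pi (Finset.countable_toSet _) fun _ _ => hmeas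
  have hPE : uniformSeq.real E = p ^ d := by
    rw [Measure.real, uniformSeq, hE, Measure.infinitePi_pi _ fun _ _ => hmeas]
    simp [volume_coe_le hp, ENNReal.toReal_ofReal hp.1]
  rw [← hPE, ← integral_indicator_one hEm]
  refine integral_mono ((integrable_const 1).indicator hEm)
    (integrable_winRate_thresholdWalk p d) fun u => ?_
  by_cases hu : u ∈ E
  · have hone : winRate (thresholdWalk p) d u = 1 :=
      winRate_thresholdWalk_eq_one hd fun k hk => hu k (by simpa using hk)
    simp [hu, hone]
  · simpa [hu] using winRate_nonneg _ d u

lemma integral_winRate_le_one (p : ℝ) (d : ℕ) :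
    ∫ u, winRate (thresholdWalk p) d u ∂uniformSeq ≤ 1 := by
  calc _ ≤ ∫ _ : ℕ → I, (1 : ℝ) ∂uniformSeq :=
        integral_mono (integrable_winRate_thresholdWalk p d) (integrable_const 1)
          fun u => winRate_le_one _ d u
    _ = 1 := by simp

lemma variance_winRate_le (p : ℝ) (d : ℕ) :
    variance (winRate (thresholdWalk p) d) uniformSeq ≤
      1 - (∫ u, winRate (thresholdWalk p) d u ∂uniformSeq) ^ 2 := by
  have hL := memLp_winRate (P := uniformSeq) (measurable_thresholdWalk p) d 2
  rw [variance_eq_sub hL]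
  gcongr
  calc _ ≤ ∫ _ : ℕ → I, (1 : ℝ) ∂uniformSeq :=
        integral_mono hL.integrable_sq (integrable_const 1) fun u =>
          pow_le_one₀ (winRate_nonneg _ d u) (winRate_le_one _ d u)
    _ = 1 := by simp

lemma tendsto_integral_winRate (hd : 0 < d) :
    Tendsto (fun p => ∫ u, winRate (thresholdWalk p) d u ∂uniformSeq)
      (𝓝[Set.Icc (0 : ℝ) 1] 1) (𝓝 1) := by
  have hpow : Tendsto (fun p : ℝ => p ^ d) (𝓝[Set.Icc (0 : ℝ) 1] 1) (𝓝 1) := by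
    simpa using ((continuous_pow d).tendsto (1 : ℝ)).mono_left nhdsWithin_le_nhds
  refine tendsto_of_tendsto_of_tendsto_of_le_of_le' hpow tendsto_const_nhds ?_
    (Eventually.of_forall fun p => integral_winRate_le_one p d)
  filter_upwards [self_mem_nhdsWithin] with p hp using pow_le_integral_winRate hd hp

lemma tendsto_variance_winRate (hd : 0 < d) :
    Tendsto (fun p => variance (winRate (thresholdWalk p) d) uniformSeq)
      (𝓝[Set.Icc (0 : ℝ) 1] 1) (𝓝 0) := by
  have hbound := ((tendsto_integral_winRate hd).pow 2).const_sub 1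
  rw [one_pow, sub_self] at hbound
  exact squeeze_zero (fun p => variance_nonneg _ _) (fun p => variance_winRate_le p d) hbound

end Coupling

/-! ### Transfer from the coupled walks to arbitrary ones. -/

theorem corollary2 (d : ℕ) (hd : 0 < d)
    (Ω : ℝ → Type*) [∀ p, MeasurableSpace (Ω p)] (P : (p : ℝ) → Measure (Ω p))
    (S : (p : ℝ) → ℕ → Ω p → ℤ)
    (hS : ∀ p ∈ Set.Icc (1 / 2 : ℝ) 1, IsBiasedWalk (P p) p (S p)) :
    (∀ p ∈ Set.Icc (1 / 2 : ℝ) 1,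
      (∀ᵐ ω ∂(P p), hitTime (S p) d ω ≠ ⊤) ∧ MemLp (winRate (S p) d) 2 (P p)) ∧
    StrictMonoOn (fun p : ℝ => ∫ ω, winRate (S p) d ω ∂(P p)) (Set.Icc (1 / 2 : ℝ) 1) ∧
    Tendsto (fun p : ℝ => ∫ ω, winRate (S p) d ω ∂(P p))
      (𝓝[Set.Icc (1 / 2 : ℝ) 1] 1) (𝓝 1) ∧
    Tendsto (fun p : ℝ => variance (winRate (S p) d) (P p))
      (𝓝[Set.Icc (1 / 2 : ℝ) 1] 1) (𝓝 0) := by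
  have hsub : Set.Icc (1 / 2 : ℝ) 1 ⊆ Set.Icc (0 : ℝ) 1 := Set.Icc_subset_Icc_left (by norm_num)
  have hid : ∀ p ∈ Set.Icc (1 / 2 : ℝ) 1, IdentDistrib (winRate (thresholdWalk p) d)
      (winRate (S p) d) uniformSeq (P p) := fun p hp =>
    (isBiasedWalk_thresholdWalk (hsub hp)).identDistrib_winRate (hS p hp) (hsub hp) d
  refine ⟨fun p hp => ⟨?_, ?_⟩, ?_, ?_, ?_⟩
  · filter_upwards [(hS p hp).ae_exists_hit hp d] with ω hω using hitTime_ne_top_iff.2 hω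
  · have := (hS p hp).isProbabilityMeasure
    exact memLp_winRate (hS p hp).measurable d 2
  · exact ((strictMonoOn_integral_winRate hd).mono hsub).congr fun p hp => (hid p hp).integral_eq
  · refine ((tendsto_integral_winRate hd).mono_left (nhdsWithin_mono 1 hsub)).congr' ?_
    filter_upwards [self_mem_nhdsWithin] with p hp using (hid p hp).integral_eq
  · refine ((tendsto_variance_winRate hd).mono_left (nhdsWithin_mono 1 hsub)).congr' ?_
    filter_upwards [self_mem_nhdsWithin] with p hp using (hid p hp).variance_eq
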